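/- Let $G=(V,\mathcal E)$ be a (finite or infinite) simple graph with real coupling constants $J_{ij}=J_{ji}$ of arbitrary signs, where $J_{ij}=0$ if $\{i,j\}\notin\mathcal E$. For each $n$ in a set $I\subseteq\{1,2,3,\dots\}$ (for instance $I=\{1,2,3,\dots\}$ when $V$ is infinite), let $V_n\subset V$ have exactly $n$ vertices, let $h=h^{(n)}\in\mathbb R^{V_n}$ be an external field and $\kappa=\kappa^{(n)}\in\{-1,1\}^{V\setminus V_n}$ a boundary condition. Extend $\sigma\in\{-1,1\}^{V_n}$ to $V$ by $\sigma_j=\kappa_j$ for $j\notin V_n$, and put \[H_n(\sigma)=-\sum_{\{i,j\}\in\mathcal E,\ \{i,j\}\cap V_n\neq\emptyset}J_{ij}\,1_{\sigma_i=\sigma_j}-\sum_{i\in V_n}h_i\sigma_i,\qquad \mu_n(\sigma)=\frac{e^{-H_n(\sigma)}}{\sum_{\sigma'\in\{-1,1\}^{V_n}}e^{-H_n(\sigma')}}.\] Let $(\varepsilon_i)_{i\in V_n}$ be a random vector with law $\mu_n$, and let \[Q_n=\sup_{x\in\mathbb R}\ \sup_{v\in\mathbb R^{V_n},\ |v_i|\ge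 1\ \forall i}P\Big(\sum_{i\in V_n}\varepsilon_iv_i\in(x-1,x+1)\Big).\] Assume that $K<\infty$ satisfies \[\sup_{n\in I}\Big(\max_{i\in V_n}\sum_{j\in V}|J_{ij}|+\max_{i\in V_n}|h_i|\Big)\le K\] (for instance, $K$ may be this supremum if it is finite). Then there is a constant $C(K)$, depending only on $K$ (not on the graph, $J$, $I$, the sets $V_n$, $h$, $\kappa$ or $n$), such that for all $n\in I$ \[\binom{n}{\lfloor n/2\rfloor}2^{-n}\le Q_n\le C(K)\,n^{-1/2}.\] -/

import Mathlib

open scoped NNReal ENNReal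

noncomputable section

namespace Ising

variable {V : Type*}

/-- The edges of `G` that have at least one endpoint in the finite volume `Λ`. -/
def edgesTouching (G : SimpleGraph V) (Λ : Finset V) : Set (Sym2 V) :=
  {e | e ∈ G.edgeSet ∧ ∃ i ∈ Λ, i ∈ e}

open Classical in
/-- The spin configuration on all of `V` that is `σ` inside `Λ` and the boundary condition `κ`
outside.  Spins take values in `ℤˣ = {1, -1}`. -/
def extend (Λ : Finset V) (κ : {j : V // j ∉ Λ} → ℤˣ) (σ : Λ → ℤˣ) : V → ℤˣ :=
  fun j => if hj : j ∈ Λ then σ ⟨j, hj⟩ else κ ⟨j, hj⟩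

/-- The set of edges `{i, j}` with `τ i = τ j`. -/
def agreeing (τ : V → ℤˣ) : Set (Sym2 V) := {e | (e.map τ).IsDiag}

theorem mem_agreeing (τ : V → ℤˣ) (i j : V) : s(i, j) ∈ agreeing τ ↔ τ i = τ j := by
  simp [agreeing]

/-- The Hamiltonian `H(σ) = - ∑_{{i,j}} J_{ij} 1_{σ_i = σ_j} - ∑_{i ∈ Λ} h_i σ_i`, the first sum
being over the (possibly infinitely many) edges touching `Λ`. -/
def hamiltonian (G : SimpleGraph V) (J : Sym2 V → ℝ) (Λ : Finset V) (h : Λ → ℝ)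
    (κ : {j : V // j ∉ Λ} → ℤˣ) (σ : Λ → ℤˣ) : ℝ :=
  -(∑' e : edgesTouching G Λ, (agreeing (extend Λ κ σ)).indicator J e)
    - ∑ i : Λ, h i * ((σ i : ℤ) : ℝ)

open Classical in
/-- The normalization constant of the Gibbs distribution. -/
def partitionFunction (G : SimpleGraph V) (J : Sym2 V → ℝ) (Λ : Finset V) (h : Λ → ℝ)
    (κ : {j : V // j ∉ Λ} → ℤˣ) : ℝ :=
  ∑ σ : Λ → ℤˣ, Real.exp (-hamiltonian G J Λ h κ σ)

open Classical in
theorem partitionFunction_pos (G : SimpleGraph V) (J : Sym2 V → ℝ) (Λ : Finset V) (h : Λ → ℝ)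
    (κ : {j : V // j ∉ Λ} → ℤˣ) : 0 < partitionFunction G J Λ h κ :=
  Finset.sum_pos (fun _ _ => Real.exp_pos _) Finset.univ_nonempty

open Classical in
/-- The Gibbs distribution `μ(σ) = exp (-H(σ)) / Z` of the Ising model in the volume `Λ`. -/
def gibbs (G : SimpleGraph V) (J : Sym2 V → ℝ) (Λ : Finset V) (h : Λ → ℝ)
    (κ : {j : V // j ∉ Λ} → ℤˣ) : PMF (Λ → ℤˣ) :=
  PMF.ofFintype
    (fun σ => ENNReal.ofReal
      (Real.exp (-hamiltonian G J Λ h κ σ) / partitionFunction G J Λ h κ))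
    (by
      have hZ := partitionFunction_pos G J Λ h κ
      rw [← ENNReal.ofReal_sum_of_nonneg
        (fun σ _ => div_nonneg (Real.exp_pos _).le hZ.le), ← Finset.sum_div]
      rw [show ∑ σ : Λ → ℤˣ, Real.exp (-hamiltonian G J Λ h κ σ)
        = partitionFunction G J Λ h κ from rfl, div_self hZ.ne', ENNReal.ofReal_one])

/-- The maximal concentration probability of a random spin vector `ε` with law `μ`: the supremum
of `P(∑ ε_i v_i ∈ (x - 1, x + 1))` over real `x` and real coefficients with `|v_i| ≥ 1`. -/
def concentration {Λ : Finset V} (μ : PMF (Λ → ℤˣ)) : ℝ≥0∞ :=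
  ⨆ (x : ℝ) (v : Λ → ℝ) (_ : ∀ i, 1 ≤ |v i|),
    μ.toOuterMeasure {ε | ∑ i : Λ, ((ε i : ℤ) : ℝ) * v i ∈ Set.Ioo (x - 1) (x + 1)}

/-- The quantity `max_{i ∈ Λ} ∑_{j ∈ V} |J_{ij}| + max_{i ∈ Λ} |h_i|`, in `[0, ∞]`. -/
def strength (J : Sym2 V → ℝ) (Λ : Finset V) (h : Λ → ℝ) : ℝ≥0∞ :=
  (⨆ i : Λ, ∑' j : V, ‖J s((i : V), j)‖ₑ) + ⨆ i : Λ, ‖h i‖ₑ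

end Ising

end

/-!
The lower bound is an averaging argument: if the coefficients `v` are independent fair signs, then for
every fixed spin vector `ε` the sum `∑ ε_i v_i` is a simple random walk, which takes its central
value with probability `n.choose (n / 2) / 2 ^ n`. Hence some choice of signs does at least as well.

For the upper bound, the Gibbs distribution is written as a mixture of product measures. Up to a
constant, `-H(ε) = ∑ w_ij ε_i ε_j + ∑ b_i ε_i` over ordered pairs in the volume, the boundary
condition being absorbed in the field `b` (`exists_neg_hamiltonian_eq`). With
`cosh (2 a) = exp (2 |w|)` and `s` the sign of `w` one has
`exp (w ε ε') = exp (-|w|) * cosh (a * (ε + s ε'))`, and the hyperbolic cosine is an average of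
`exp (ξ a (ε + s ε'))` over a hidden spin `ξ = ±1`. With one hidden spin for each pair,
the law of `ε` given `ξ` is a product measure with fields `u_i(ξ)`, linear in `ξ`
(`exp_pair_interaction_eq`); this works whatever the signs of the couplings.

For a product measure with fields `u_i`, each spin is fair with probability `q_i ≥ exp (-2 |u_i|)`
and deterministic otherwise. Given the set of fair spins, Sperner's theorem gives the
Littlewood-Offord bound of Erdős (`card_window_agree_le_choose`), and averaging over that set gives
concentration at most `(∑ q_i) ^ (-1 / 2)` (`sum_window_prod_mixture_le`). By Cauchy-Schwarz
this is at most `n ^ (-3 / 2) * ∑ exp |u_i|`, so it remains to bound the mean of `exp |u_i(ξ)|`.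
Given `ε`, the hidden spins are independent with tilts of order `a`, and `u_i` is a
linear combination of them with coefficients of order `a`, so this mean is at most
`exp (O(K + ∑ a ^ 2))`, the sum being over the pairs that contain `i`
(`sum_exp_abs_hiddenField_le`). As `a ^ 2 ≤ |w| exp (2 |w|)`, it is bounded in terms of `K` alone.
-/

namespace Ising

/-! ### Concentration of product measures -/

/-- Apply the Cauchy-Schwarz inequality twice: `(∑ y) ^ 2 ≤ n * ∑ y ^ 2` and
`n ^ 2 ≤ (∑ y) * ∑ y⁻¹`. -/
theorem sqrt_inv_sum_sq_le {ι : Type*} [Fintype ι] [Nonempty ι] (y : ι → ℝ) (hy : ∀ i, 0 < y i) :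
    Real.sqrt (1 / ∑ i, y i ^ 2)
      ≤ 1 / (Real.sqrt (Fintype.card ι) * Fintype.card ι) * ∑ i, (y i)⁻¹ := by
  set n : ℝ := (Fintype.card ι : ℝ) with hn
  have hn0 : 0 < n := by rw [hn]; exact_mod_cast Fintype.card_pos
  have hA : 0 < ∑ i, y i ^ 2 :=
    Finset.sum_pos (fun i _ => by have := hy i; positivity) Finset.univ_nonempty
  have hB : 0 < ∑ i, (y i)⁻¹ :=
    Finset.sum_pos (fun i _ => inv_pos.2 (hy i)) Finset.univ_nonempty
  have hS : 0 < ∑ i, y i := Finset.sum_pos (fun i _ => hy i) Finset.univ_nonempty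
  have h1 : (∑ i, y i) ^ 2 ≤ n * ∑ i, y i ^ 2 := by
    simpa [hn] using sq_sum_le_card_mul_sum_sq (s := Finset.univ) (f := y)
  have h2 : n ^ 2 ≤ (∑ i, y i) * ∑ i, (y i)⁻¹ := by
    have := Finset.sum_sq_le_sum_mul_sum_of_sq_le_mul Finset.univ (f := y) (r := fun _ => (1 : ℝ))
      (g := fun i => (y i)⁻¹) (fun i _ => (hy i).le) (fun i _ => (inv_pos.2 (hy i)).le)
      (fun i _ => by rw [mul_inv_cancel₀ (hy i).ne', one_pow])
    simpa [hn] using this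
  apply Real.sqrt_le_iff.2 ⟨by positivity, ?_⟩
  rw [mul_pow, div_pow, mul_pow, Real.sq_sqrt hn0.le, one_pow, div_mul_eq_mul_div, one_mul,
    div_le_div_iff₀ hA (by positivity), one_mul]
  have h3 : (n ^ 2) ^ 2 ≤ ((∑ i, y i) * ∑ i, (y i)⁻¹) ^ 2 := by gcongr
  have h4 : (n ^ 2) ^ 2 ≤ n * (∑ i, y i ^ 2) * (∑ i, (y i)⁻¹) ^ 2 := by
    refine h3.trans ?_
    rw [mul_pow]
    gcongr
  have h5 : n * (n * n ^ 2) ≤ n * ((∑ i, (y i)⁻¹) ^ 2 * ∑ i, y i ^ 2) := by linarith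
  exact le_of_mul_le_mul_left h5 hn0

section ProductMeasure

variable {ι : Type*} [Fintype ι] [DecidableEq ι]

theorem spin_cast_eq (s : ℤˣ) : ((s : ℤ) : ℝ) = 1 ∨ ((s : ℤ) : ℝ) = -1 := by
  rcases Int.units_eq_one_or s with h | h <;> simp [h]

/-- The Littlewood-Offord bound of Erdős with the spins outside `S` frozen to `τ`. As `2 * |v i| ≥ 2`
is at least the length of the open window, the sets `{i ∈ S | 0 < ε i * v i}` form an antichain. -/
theorem card_window_agree_le_choose (v : ι → ℝ) (hv : ∀ i, 1 ≤ |v i|) (x : ℝ) (τ : ι → ℤˣ)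
    (S : Finset ι) :
    (Finset.univ.filter fun ε : ι → ℤˣ =>
      ∑ i, ((ε i : ℤ) : ℝ) * v i ∈ Set.Ioo (x - 1) (x + 1) ∧ ∀ i ∉ S, ε i = τ i).card
      ≤ S.card.choose (S.card / 2) := by
  classical
  set A := Finset.univ.filter fun ε : ι → ℤˣ =>
      ∑ i, ((ε i : ℤ) : ℝ) * v i ∈ Set.Ioo (x - 1) (x + 1) ∧ ∀ i ∉ S, ε i = τ i with hA
  let F : (ι → ℤˣ) → Finset S := fun ε => Finset.univ.filter fun i => 0 < ((ε i : ℤ) : ℝ) * v i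
  have key : ∀ ε ∈ A, ∀ ε' ∈ A, F ε ⊆ F ε' → ε = ε' := by
    intro ε hε ε' hε' hsub
    simp only [hA, Finset.mem_filter, Finset.mem_univ, true_and] at hε hε'
    have hstep : ∀ i, ε i ≠ ε' i →
        2 ≤ ((ε' i : ℤ) : ℝ) * v i - ((ε i : ℤ) : ℝ) * v i := by
      intro i hi
      have hiS : i ∈ S := by
        by_contra h
        exact hi ((hε.2 i h).trans (hε'.2 i h).symm)
      have himp : 0 < ((ε i : ℤ) : ℝ) * v i → 0 < ((ε' i : ℤ) : ℝ) * v i := by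
        intro h
        have : (⟨i, hiS⟩ : S) ∈ F ε := by simpa [F] using h
        simpa [F] using hsub this
      have h1 := hv i
      rcases Int.units_eq_one_or (ε i) with h | h <;>
        rcases Int.units_eq_one_or (ε' i) with h' | h' <;>
        rcases abs_cases (v i) with ⟨ha, hb⟩ | ⟨ha, hb⟩ <;>
        simp only [h, h', ne_eq, not_true_eq_false, Units.val_one, Units.val_neg, Int.cast_one,
          Int.cast_neg] at hi himp ⊢ <;> first | linarith | (have := himp (by linarith); linarith)
    by_contra hne
    obtain ⟨i, hi⟩ := Function.ne_iff.mp hne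
    have hnn : ∀ j ∈ Finset.univ, 0 ≤ ((ε' j : ℤ) : ℝ) * v j - ((ε j : ℤ) : ℝ) * v j := by
      intro j _
      by_cases hj : ε j = ε' j
      · simp [hj]
      · linarith [hstep j hj]
    have := (hstep i hi).trans (Finset.single_le_sum hnn (Finset.mem_univ i))
    rw [Finset.sum_sub_distrib] at this
    linarith [hε.1.1, hε'.1.2]
  have hinj : Set.InjOn F A := fun ε hε ε' hε' h => key ε hε ε' hε' h.subset
  rw [← Finset.card_image_of_injOn hinj]
  have hanti : IsAntichain (· ⊆ ·) ((A.image F : Finset (Finset S)) : Set (Finset S)) := by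
    intro a ha b hb hab hsub
    simp only [Finset.coe_image, Set.mem_image, Finset.mem_coe] at ha hb
    obtain ⟨ε, hε, rfl⟩ := ha
    obtain ⟨ε', hε', rfl⟩ := hb
    exact hab (by rw [key ε hε ε' hε' hsub])
  simpa using hanti.sperner

/-- The central binomial coefficient divided by `4 ^ n` is at most `(2 * n + 1) ^ (-1 / 2)`. -/
theorem sq_centralBinom_mul_le (n : ℕ) : n.centralBinom ^ 2 * (2 * n + 1) ≤ 16 ^ n := by
  induction n with
  | zero => simp
  | succ n ih =>
    have h := Nat.succ_mul_centralBinom_succ n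
    have h2 : (n + 1) ^ 2 * ((n + 1).centralBinom ^ 2 * (2 * (n + 1) + 1))
        ≤ (n + 1) ^ 2 * 16 ^ (n + 1) := by
      calc (n + 1) ^ 2 * ((n + 1).centralBinom ^ 2 * (2 * (n + 1) + 1))
          = ((n + 1) * (n + 1).centralBinom) ^ 2 * (2 * n + 3) := by ring
        _ = (n.centralBinom ^ 2 * (2 * n + 1)) * (4 * ((2 * n + 1) * (2 * n + 3))) := by
          rw [h]; ring
        _ ≤ 16 ^ n * (16 * (n + 1) ^ 2) := by
          apply Nat.mul_le_mul ih
          nlinarith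
        _ = _ := by ring
    exact Nat.le_of_mul_le_mul_left h2 (by positivity)

theorem sq_choose_half_mul_le (n : ℕ) : n.choose (n / 2) ^ 2 * (n + 1) ≤ 4 ^ n := by
  obtain ⟨m, rfl | rfl⟩ := Nat.even_or_odd' n
  · rw [Nat.mul_div_cancel_left _ two_pos, ← Nat.centralBinom_eq_two_mul_choose, pow_mul]
    exact sq_centralBinom_mul_le m
  · have h := sq_centralBinom_mul_le (m + 1)
    have h2 : (m + 1).centralBinom = 2 * (2 * m + 1).choose m := by
      rw [Nat.centralBinom_eq_two_mul_choose, show 2 * (m + 1) = 2 * m + 1 + 1 by ring,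
        Nat.choose_succ_succ, Nat.choose_symm_half]
      ring
    rw [h2] at h
    rw [show (2 * m + 1) / 2 = m by omega]
    have h3 : (4 : ℕ) ^ (2 * m + 1) * 4 = 16 ^ (m + 1) := by
      rw [← pow_succ, show 2 * m + 1 + 1 = 2 * (m + 1) by ring, pow_mul]
      norm_num
    nlinarith

theorem choose_half_div_le (n : ℕ) :
    (n.choose (n / 2) : ℝ) / 2 ^ n ≤ Real.sqrt (1 / ((n : ℝ) + 1)) := by
  apply Real.le_sqrt_of_sq_le
  rw [div_pow, div_le_div_iff₀ (by positivity) (by positivity), ← pow_mul, mul_comm n 2, pow_mul]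
  have := sq_choose_half_mul_le n
  norm_num
  exact_mod_cast this

/-- `E[1 / (T + 1)] ≤ 1 / E[T]` for the size `T` of a random set that contains each `i` independently
with probability `q i`: integrate `E[t ^ T] ≤ exp ((t - 1) * E[T])` over `t ∈ [0, 1]`. -/
theorem sum_bernoulli_div_card_add_one_le (q : ι → ℝ) (h0 : ∀ i, 0 ≤ q i) (h1 : ∀ i, q i ≤ 1)
    (hm : 0 < ∑ i, q i) :
    ∑ S : Finset ι, (∏ i ∈ S, q i) * (∏ i ∈ Sᶜ, (1 - q i)) * (1 / ((S.card : ℝ) + 1))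
      ≤ 1 / ∑ i, q i := by
  set m := ∑ i, q i with hmdef
  have hint : ∀ k : ℕ, 1 / ((k : ℝ) + 1) = ∫ t in (0 : ℝ)..1, t ^ k := by
    intro k; simp [integral_pow]
  have hgen : ∀ t : ℝ, ∑ S : Finset ι, (∏ i ∈ S, q i) * (∏ i ∈ Sᶜ, (1 - q i)) * t ^ S.card
      = ∏ i, (q i * t + (1 - q i)) := by
    intro t
    rw [Fintype.prod_add]
    refine Finset.sum_congr rfl fun S _ => ?_
    rw [Finset.prod_mul_distrib, Finset.prod_const]
    ring
  have hle : ∀ t ∈ Set.Icc (0 : ℝ) 1, ∏ i, (q i * t + (1 - q i)) ≤ Real.exp (m * (t - 1)) := by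
    intro t ht
    rw [hmdef, Finset.sum_mul, Real.exp_sum]
    refine Finset.prod_le_prod (fun i _ => ?_) fun i _ => ?_
    · nlinarith [h0 i, h1 i, ht.1, mul_nonneg (h0 i) ht.1]
    · linarith [Real.add_one_le_exp (q i * (t - 1))]
  have hexp : ∫ t in (0 : ℝ)..1, Real.exp (m * (t - 1)) = (1 - Real.exp (-m)) / m := by
    have : ∀ t ∈ Set.uIcc (0 : ℝ) 1,
        HasDerivAt (fun t => Real.exp (m * (t - 1)) / m) (Real.exp (m * (t - 1))) t := by
      intro t _
      have h := (((hasDerivAt_id t).sub_const 1).const_mul m).exp.div_const m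
      exact h.congr_deriv (by simp only [id]; field_simp)
    rw [intervalIntegral.integral_eq_sub_of_hasDerivAt this
      (Continuous.intervalIntegrable (by fun_prop) _ _)]
    simp
    ring
  calc _ = ∫ t in (0 : ℝ)..1, ∏ i, (q i * t + (1 - q i)) := by
        simp_rw [← hgen, hint]
        rw [intervalIntegral.integral_finsetSum]
        · simp_rw [intervalIntegral.integral_const_mul]
        · intro S _
          exact Continuous.intervalIntegrable (by fun_prop) _ _
    _ ≤ ∫ t in (0 : ℝ)..1, Real.exp (m * (t - 1)) :=
        intervalIntegral.integral_mono_on zero_le_one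
          (Continuous.intervalIntegrable (by fun_prop) _ _)
          (Continuous.intervalIntegrable (by fun_prop) _ _) hle
    _ ≤ 1 / m := by
        rw [hexp]
        gcongr
        linarith [Real.exp_pos (-m)]

/-- Concentration of independent spins, where the spin at `i` is fair with probability `q i` and
equal to `τ i` otherwise. -/
theorem sum_window_prod_mixture_le (v : ι → ℝ) (hv : ∀ i, 1 ≤ |v i|) (x : ℝ) (τ : ι → ℤˣ)
    (q : ι → ℝ) (h0 : ∀ i, 0 ≤ q i) (h1 : ∀ i, q i ≤ 1) (hm : 0 < ∑ i, q i) :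
    ∑ ε : ι → ℤˣ with ∑ i, ((ε i : ℤ) : ℝ) * v i ∈ Set.Ioo (x - 1) (x + 1),
      ∏ i, (q i / 2 + if ε i = τ i then 1 - q i else 0) ≤ Real.sqrt (1 / ∑ i, q i) := by
  set p : Finset ι → ℝ := fun S => (∏ i ∈ S, q i) * ∏ i ∈ Sᶜ, (1 - q i) with hp
  have hp0 : ∀ S, 0 ≤ p S := fun S =>
    mul_nonneg (Finset.prod_nonneg fun i _ => h0 i)
      (Finset.prod_nonneg fun i _ => sub_nonneg.2 (h1 i))
  have hp1 : ∑ S, p S = 1 := by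
    rw [hp, ← Fintype.prod_add]; simp
  -- `S` is the set of fair spins, chosen with probability `p S`
  calc _ = ∑ S : Finset ι, p S * (((Finset.univ.filter fun ε : ι → ℤˣ =>
          ∑ i, ((ε i : ℤ) : ℝ) * v i ∈ Set.Ioo (x - 1) (x + 1) ∧ ∀ i ∉ S, ε i = τ i).card : ℝ)
            / 2 ^ S.card) := by
        simp_rw [Fintype.prod_add]
        rw [Finset.sum_comm]
        refine Finset.sum_congr rfl fun S _ => ?_
        have : ∀ ε : ι → ℤˣ, (∏ i ∈ S, q i / 2) * ∏ i ∈ Sᶜ, (if ε i = τ i then 1 - q i else 0)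
            = if ∀ i ∉ S, ε i = τ i then p S / 2 ^ S.card else 0 := by
          intro ε
          rw [Finset.prod_div_distrib, Finset.prod_const]
          split_ifs with h
          · rw [Finset.prod_congr rfl (g := fun i => 1 - q i)
              fun i hi => if_pos (h i (Finset.mem_compl.1 hi))]
            ring
          · push Not at h
            obtain ⟨i, hi, hne⟩ := h
            rw [Finset.prod_eq_zero (Finset.mem_compl.2 hi) (if_neg hne), mul_zero]
        simp_rw [this]
        rw [← Finset.sum_filter, Finset.filter_filter, Finset.sum_const, nsmul_eq_mul]
        ring
    _ ≤ ∑ S : Finset ι, p S * Real.sqrt (1 / ((S.card : ℝ) + 1)) := by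
        refine Finset.sum_le_sum fun S _ => mul_le_mul_of_nonneg_left ?_ (hp0 S)
        refine le_trans ?_ (choose_half_div_le S.card)
        gcongr
        exact card_window_agree_le_choose v hv x τ S
    _ ≤ Real.sqrt (∑ S : Finset ι, p S * (1 / ((S.card : ℝ) + 1))) := by
        -- Jensen's inequality for the square root, in its Cauchy-Schwarz form
        apply Real.le_sqrt_of_sq_le
        have := Finset.sum_sq_le_sum_mul_sum_of_sq_le_mul Finset.univ (f := p)
          (r := fun S => p S * Real.sqrt (1 / ((S.card : ℝ) + 1)))
          (g := fun S => p S * (1 / ((S.card : ℝ) + 1))) (fun S _ => hp0 S)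
          (fun S _ => mul_nonneg (hp0 S) (by positivity))
          (fun S _ => (by rw [mul_pow, Real.sq_sqrt (by positivity)]; ring : _ = _).le)
        rwa [hp1, one_mul] at this
    _ ≤ Real.sqrt (1 / ∑ i, q i) :=
        Real.sqrt_le_sqrt (sum_bernoulli_div_card_add_one_le q h0 h1 hm)

theorem sum_spin (f : ℤˣ → ℝ) : ∑ s, f s = f 1 + f (-1) := by
  rw [UnitsInt.univ, Finset.sum_pair (by decide)]

/-- The partition function of independent spins in the field `u`. -/
theorem sum_exp_linear (u : ι → ℝ) :
    ∑ ε : ι → ℤˣ, Real.exp (∑ i, u i * ((ε i : ℤ) : ℝ)) = ∏ i, (2 * Real.cosh (u i)) := by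
  have : ∀ i, 2 * Real.cosh (u i) = ∑ s : ℤˣ, Real.exp (u i * ((s : ℤ) : ℝ)) := by
    intro i
    rw [sum_spin, Real.cosh_eq]
    simp
    ring
  simp_rw [this, Real.exp_sum]
  rw [Fintype.prod_sum]

/-- Concentration of independent spins in the field `u`. -/
theorem sum_window_exp_linear_le (v : ι → ℝ) (hv : ∀ i, 1 ≤ |v i|) (x : ℝ) (u : ι → ℝ)
    [Nonempty ι] :
    ∑ ε : ι → ℤˣ with ∑ i, ((ε i : ℤ) : ℝ) * v i ∈ Set.Ioo (x - 1) (x + 1),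
      Real.exp (∑ i, u i * ((ε i : ℤ) : ℝ))
      ≤ Real.sqrt (1 / ∑ i, Real.exp (-|u i|) ^ 2) *
        ∑ ε : ι → ℤˣ, Real.exp (∑ i, u i * ((ε i : ℤ) : ℝ)) := by
  -- a spin is fair with probability `q i` and otherwise equals the favoured sign `τ i`
  set q : ι → ℝ := fun i => Real.exp (-|u i|) / Real.cosh (u i) with hq
  set τ : ι → ℤˣ := fun i => if 0 ≤ u i then 1 else -1 with hτ
  have hq0 : ∀ i, 0 < q i := fun i => div_pos (Real.exp_pos _) (Real.cosh_pos _)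
  have hcosh : ∀ i, 2 * Real.cosh (u i) = Real.exp |u i| + Real.exp (-|u i|) := by
    intro i
    rw [← Real.cosh_abs, Real.cosh_eq]; ring
  have hle : ∀ i, Real.exp (-|u i|) ≤ Real.exp |u i| := fun i =>
    Real.exp_le_exp.2 (by linarith [abs_nonneg (u i)])
  have hq1 : ∀ i, q i ≤ 1 := by
    intro i
    rw [hq, div_le_one (Real.cosh_pos _)]
    linarith [hcosh i, hle i]
  have hqge : ∀ i, Real.exp (-|u i|) ^ 2 ≤ q i := by
    intro i
    rw [hq, le_div_iff₀ (Real.cosh_pos _)]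
    have h1 : Real.cosh (u i) ≤ Real.exp |u i| := by linarith [hcosh i, hle i]
    have h2 : Real.exp (-|u i|) * Real.exp |u i| = 1 := by rw [← Real.exp_add]; simp
    have h3 := Real.exp_pos (-|u i|)
    calc Real.exp (-|u i|) ^ 2 * Real.cosh (u i)
        ≤ Real.exp (-|u i|) ^ 2 * Real.exp |u i| := by gcongr
      _ = Real.exp (-|u i|) := by rw [pow_two, mul_assoc, h2, mul_one]
  have hfac : ∀ (ε : ι → ℤˣ) (i : ι), Real.exp (u i * ((ε i : ℤ) : ℝ))
      = 2 * Real.cosh (u i) * (q i / 2 + if ε i = τ i then 1 - q i else 0) := by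
    intro ε i
    have hc := Real.cosh_pos (u i)
    have h2 : 2 * Real.cosh (u i) * (q i / 2) = Real.exp (-|u i|) := by
      rw [hq]; field_simp
    have h3 : 2 * Real.cosh (u i) * (1 - q i) = Real.exp |u i| - Real.exp (-|u i|) := by
      have := hcosh i
      linarith
    rw [mul_add, h2, mul_ite, h3, mul_zero]
    rcases Int.units_eq_one_or (ε i) with h | h <;> rw [h] <;>
      by_cases hu : 0 ≤ u i
    · simp [hτ, hu, abs_of_nonneg hu]
    · have hu' := (not_le.1 hu).le
      rw [if_neg (by simp only [hτ, hu, if_false]; decide)]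
      simp [abs_of_nonpos hu']
    · rw [if_neg (by simp only [hτ, hu, if_true]; decide)]
      simp [abs_of_nonneg hu]
    · have hu' := (not_le.1 hu).le
      simp [hτ, hu, abs_of_nonpos hu']
  have hmain := sum_window_prod_mixture_le v hv x τ q (fun i => (hq0 i).le) hq1
    (Finset.sum_pos (fun i _ => hq0 i) Finset.univ_nonempty)
  rw [sum_exp_linear]
  simp_rw [Real.exp_sum, hfac, Finset.prod_mul_distrib]
  simp_rw [← Finset.mul_sum]
  rw [← Finset.prod_mul_distrib, mul_comm]
  refine mul_le_mul_of_nonneg_right (hmain.trans (Real.sqrt_le_sqrt ?_)) ?_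
  · exact one_div_le_one_div_of_le (Finset.sum_pos (fun i _ => by positivity)
      Finset.univ_nonempty) (Finset.sum_le_sum fun i _ => hqge i)
  · exact Finset.prod_nonneg fun i _ => by have := Real.cosh_pos (u i); positivity

end ProductMeasure

/-! ### Mixtures of product measures -/

section HiddenField

variable {ι E : Type*} [Fintype ι] [Fintype E]

/-- The field at the site `i` created by the external field `b` and by the hidden spins `ξ`, where
`M i e` couples the site `i` with the hidden spin `e`. -/
noncomputable def hiddenField (M : ι → E → ℝ) (b : ι → ℝ) (ξ : E → ℤˣ) (i : ι) : ℝ :=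
  b i + ∑ e, M i e * ((ξ e : ℤ) : ℝ)

/-- The same energy, read as an energy of the hidden spins `ξ` for given `ε`. -/
theorem sum_hiddenField_mul (M : ι → E → ℝ) (b : ι → ℝ) (ξ : E → ℤˣ) (ε : ι → ℤˣ) :
    ∑ i, hiddenField M b ξ i * ((ε i : ℤ) : ℝ)
      = ∑ i, b i * ((ε i : ℤ) : ℝ)
        + ∑ e, (∑ i, M i e * ((ε i : ℤ) : ℝ)) * ((ξ e : ℤ) : ℝ) := by
  simp only [hiddenField, add_mul, Finset.sum_add_distrib, Finset.sum_mul]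
  rw [Finset.sum_comm]
  congr 1
  refine Finset.sum_congr rfl fun e _ => Finset.sum_congr rfl fun i _ => by ring

end HiddenField

section Mixture

theorem abs_sinh_le (x : ℝ) : |Real.sinh x| ≤ 2 * |x| * Real.cosh x := by
  have key : ∀ y : ℝ, 0 ≤ y → Real.sinh y ≤ 2 * y * Real.cosh y := by
    intro y hy
    rw [Real.sinh_eq, Real.cosh_eq]
    have h1 := Real.add_one_le_exp (-(2 * y))
    have h2 : Real.exp (-y) = Real.exp (-(2 * y)) * Real.exp y := by
      rw [← Real.exp_add]; ring_nf
    have h3 := Real.exp_pos y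
    have h4 := mul_le_mul_of_nonneg_right h1 h3.le
    have h5 : 0 ≤ y * Real.exp (-y) := by positivity
    nlinarith
  rw [← Real.cosh_abs, Real.abs_sinh]
  exact key _ (abs_nonneg x)

theorem cosh_add_le (t c : ℝ) :
    Real.cosh (t + c) ≤ Real.cosh t * Real.exp (4 * |t| * |c| + c ^ 2 / 2) := by
  have ht := Real.cosh_pos t
  have hc := Real.cosh_pos c
  have h1 : Real.sinh t * Real.sinh c
      ≤ (2 * |t| * Real.cosh t) * (2 * |c| * Real.cosh c) := by
    refine (le_abs_self _).trans ?_
    rw [abs_mul]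
    exact mul_le_mul (abs_sinh_le t) (abs_sinh_le c) (abs_nonneg _) (by positivity)
  calc Real.cosh (t + c) = Real.cosh t * Real.cosh c + Real.sinh t * Real.sinh c :=
        Real.cosh_add t c
    _ ≤ Real.cosh t * ((4 * |t| * |c| + 1) * Real.cosh c) := by linarith
    _ ≤ Real.cosh t * (Real.exp (4 * |t| * |c|) * Real.exp (c ^ 2 / 2)) := by
        gcongr
        · exact Real.add_one_le_exp _
        · exact Real.cosh_le_exp_half_sq c
    _ = _ := by rw [Real.exp_add]

variable {E : Type*} [Fintype E] [DecidableEq E]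

/-- Changing the field of independent spins from `t` to `t + c` costs a factor that is bounded
as soon as `∑ |t e| |c e|` and `∑ c e ^ 2` are. -/
theorem sum_exp_linear_add_le (t c : E → ℝ) :
    ∑ ξ : E → ℤˣ, Real.exp (∑ e, (t e + c e) * ((ξ e : ℤ) : ℝ))
      ≤ Real.exp (∑ e, (4 * |t e| * |c e| + c e ^ 2 / 2)) *
        ∑ ξ : E → ℤˣ, Real.exp (∑ e, t e * ((ξ e : ℤ) : ℝ)) := by
  rw [sum_exp_linear, sum_exp_linear, Real.exp_sum, ← Finset.prod_mul_distrib]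
  refine Finset.prod_le_prod (fun e _ => ?_) fun e _ => ?_
  · have := Real.cosh_pos (t e + c e); positivity
  · linarith [cosh_add_le (t e) (c e)]

/-- A bound for the exponential moment of a linear form in independent spins in the field `t`. -/
theorem sum_exp_abs_mul_exp_linear_le (t c : E → ℝ) :
    ∑ ξ : E → ℤˣ, Real.exp |∑ e, c e * ((ξ e : ℤ) : ℝ)| *
        Real.exp (∑ e, t e * ((ξ e : ℤ) : ℝ))
      ≤ 2 * Real.exp (∑ e, (4 * |t e| * |c e| + c e ^ 2 / 2)) *
        ∑ ξ : E → ℤˣ, Real.exp (∑ e, t e * ((ξ e : ℤ) : ℝ)) := by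
  have hp := sum_exp_linear_add_le t c
  have hn := sum_exp_linear_add_le t (fun e => -c e)
  simp only [abs_neg, neg_sq] at hn
  refine le_trans ?_ ((add_le_add hp hn).trans_eq (by ring))
  rw [← Finset.sum_add_distrib]
  refine Finset.sum_le_sum fun ξ _ => ?_
  simp only [add_mul, Finset.sum_add_distrib, neg_mul, Finset.sum_neg_distrib, Real.exp_add]
  rcases abs_cases (∑ e, c e * ((ξ e : ℤ) : ℝ)) with ⟨h, _⟩ | ⟨h, _⟩ <;> rw [h] <;>
    nlinarith [Real.exp_pos (∑ e, c e * ((ξ e : ℤ) : ℝ)),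
      Real.exp_pos (-∑ e, c e * ((ξ e : ℤ) : ℝ)), Real.exp_pos (∑ e, t e * ((ξ e : ℤ) : ℝ)),
      mul_pos (Real.exp_pos (∑ e, c e * ((ξ e : ℤ) : ℝ)))
        (Real.exp_pos (∑ e, t e * ((ξ e : ℤ) : ℝ))),
      mul_pos (Real.exp_pos (-∑ e, c e * ((ξ e : ℤ) : ℝ)))
        (Real.exp_pos (∑ e, t e * ((ξ e : ℤ) : ℝ)))]

variable {ι : Type*} [Fintype ι]

/-- Given `ε`, the mean of `exp |u_i|` over the hidden spins is at most `2 * exp (L + D)`. -/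
theorem sum_exp_abs_hiddenField_le (M : ι → E → ℝ) (b : ι → ℝ) (L D : ℝ)
    (ε : ι → ℤˣ) (i : ι) (hb : |b i| ≤ L)
    (hD : ∑ e, (4 * |∑ k, M k e * ((ε k : ℤ) : ℝ)| * |M i e| + M i e ^ 2 / 2) ≤ D) :
    ∑ ξ : E → ℤˣ, Real.exp |hiddenField M b ξ i| *
        Real.exp (∑ k, hiddenField M b ξ k * ((ε k : ℤ) : ℝ))
      ≤ 2 * Real.exp (L + D) *
        ∑ ξ : E → ℤˣ, Real.exp (∑ k, hiddenField M b ξ k * ((ε k : ℤ) : ℝ)) := by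
  simp_rw [sum_hiddenField_mul, Real.exp_add]
  rw [← Finset.mul_sum]
  set B := Real.exp (∑ i, b i * ((ε i : ℤ) : ℝ)) with hB
  have hB0 : 0 < B := Real.exp_pos _
  have h := sum_exp_abs_mul_exp_linear_le (fun e => ∑ k, M k e * ((ε k : ℤ) : ℝ)) (M i)
  calc _ ≤ ∑ ξ : E → ℤˣ, (Real.exp L * B) * (Real.exp |∑ e, M i e * ((ξ e : ℤ) : ℝ)| *
          Real.exp (∑ e, (∑ k, M k e * ((ε k : ℤ) : ℝ)) * ((ξ e : ℤ) : ℝ))) := by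
        refine Finset.sum_le_sum fun ξ _ => ?_
        have h1 : Real.exp |hiddenField M b ξ i|
            ≤ Real.exp L * Real.exp |∑ e, M i e * ((ξ e : ℤ) : ℝ)| := by
          rw [← Real.exp_add]
          refine Real.exp_le_exp.2 ((abs_add_le _ _).trans (by linarith))
        refine (mul_le_mul_of_nonneg_right h1 (by positivity)).trans_eq (by ring)
    _ ≤ (Real.exp L * B) * (2 * Real.exp D *
        ∑ ξ : E → ℤˣ, Real.exp (∑ e, (∑ k, M k e * ((ε k : ℤ) : ℝ)) * ((ξ e : ℤ) : ℝ))) := by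
        rw [← Finset.mul_sum]
        refine mul_le_mul_of_nonneg_left (h.trans ?_) (by positivity)
        gcongr
    _ = _ := by ring

variable [DecidableEq ι]

/-- Concentration of a mixture of product measures: the bound for product measures is linear in
`exp |u_i|`, so that only the mean of that quantity matters. -/
theorem sum_window_mixture_le [Nonempty ι] (v : ι → ℝ) (hv : ∀ i, 1 ≤ |v i|) (x : ℝ)
    (M : ι → E → ℝ) (b : ι → ℝ) (L D : ℝ) (hb : ∀ i, |b i| ≤ L)
    (hD : ∀ (ε : ι → ℤˣ) (i : ι),
      ∑ e, (4 * |∑ k, M k e * ((ε k : ℤ) : ℝ)| * |M i e| + M i e ^ 2 / 2) ≤ D) :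
    ∑ ε : ι → ℤˣ with ∑ i, ((ε i : ℤ) : ℝ) * v i ∈ Set.Ioo (x - 1) (x + 1),
      ∑ ξ : E → ℤˣ, Real.exp (∑ i, hiddenField M b ξ i * ((ε i : ℤ) : ℝ))
      ≤ 2 * Real.exp (L + D) / Real.sqrt (Fintype.card ι) *
        ∑ ε : ι → ℤˣ, ∑ ξ : E → ℤˣ,
          Real.exp (∑ i, hiddenField M b ξ i * ((ε i : ℤ) : ℝ)) := by
  set W : (ι → ℤˣ) → (E → ℤˣ) → ℝ := fun ε ξ =>
    Real.exp (∑ i, hiddenField M b ξ i * ((ε i : ℤ) : ℝ)) with hW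
  set n : ℝ := (Fintype.card ι : ℝ) with hn
  have hn0 : 0 < n := by rw [hn]; exact_mod_cast Fintype.card_pos
  calc _ = ∑ ξ : E → ℤˣ,
        ∑ ε : ι → ℤˣ with ∑ i, ((ε i : ℤ) : ℝ) * v i ∈ Set.Ioo (x - 1) (x + 1), W ε ξ :=
        Finset.sum_comm
    _ ≤ ∑ ξ : E → ℤˣ, (1 / (Real.sqrt n * n) * ∑ i, Real.exp |hiddenField M b ξ i|) *
          ∑ ε : ι → ℤˣ, W ε ξ := by
        refine Finset.sum_le_sum fun ξ _ => ?_
        refine (sum_window_exp_linear_le v hv x (hiddenField M b ξ)).trans ?_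
        refine mul_le_mul_of_nonneg_right ?_ (Finset.sum_nonneg fun _ _ => (Real.exp_pos _).le)
        refine (sqrt_inv_sum_sq_le (fun i => Real.exp (-|hiddenField M b ξ i|))
          fun i => Real.exp_pos _).trans_eq ?_
        simp [Real.exp_neg, hn]
    _ = 1 / (Real.sqrt n * n) *
          ∑ i, ∑ ε : ι → ℤˣ, ∑ ξ : E → ℤˣ, Real.exp |hiddenField M b ξ i| * W ε ξ := by
        simp_rw [mul_assoc, ← Finset.mul_sum, Finset.sum_mul_sum]
        rw [Finset.sum_comm]
        congr 1
        refine Finset.sum_congr rfl fun i _ => ?_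
        rw [Finset.sum_comm]
    _ ≤ 1 / (Real.sqrt n * n) *
          ∑ _i : ι, ∑ ε : ι → ℤˣ, 2 * Real.exp (L + D) * ∑ ξ : E → ℤˣ, W ε ξ := by
        gcongr with i _ ε _
        exact sum_exp_abs_hiddenField_le M b L D ε i (hb i) (hD ε i)
    _ = _ := by
        rw [Finset.sum_const, Finset.card_univ, nsmul_eq_mul, ← Finset.mul_sum, ← hn]
        field_simp
        rfl

/-! ### Hidden spins for a pair interaction -/

/-- The nonnegative `a` with `cosh (2 a) = exp (2 |w|)`: the strength with which a hidden spin has to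
be coupled to two spins in order to create an interaction of strength `|w|` between them. -/
noncomputable def hiddenCoupling (w : ℝ) : ℝ := Real.arcosh (Real.exp (2 * |w|)) / 2

theorem cosh_two_mul_hiddenCoupling (w : ℝ) :
    Real.cosh (2 * hiddenCoupling w) = Real.exp (2 * |w|) := by
  rw [hiddenCoupling, mul_div_cancel₀ _ two_ne_zero, Real.cosh_arcosh]
  exact Real.one_le_exp (by positivity)

/-- From `1 + 2 * a ^ 2 ≤ cosh (2 * a) = exp (2 * |w|)`. -/
theorem sq_hiddenCoupling_le (w : ℝ) : hiddenCoupling w ^ 2 ≤ |w| * Real.exp (2 * |w|) := by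
  have h1 : 1 + 2 * hiddenCoupling w ^ 2 ≤ Real.exp (2 * |w|) := by
    rw [← cosh_two_mul_hiddenCoupling, Real.cosh_two_mul, Real.cosh_sq]
    have : hiddenCoupling w ^ 2 ≤ Real.sinh (hiddenCoupling w) ^ 2 := by
      rw [sq_le_sq, Real.abs_sinh]
      exact Real.self_le_sinh_iff.2 (abs_nonneg _)
    linarith
  have h2 := Real.add_one_le_exp (-(2 * |w|))
  have h3 : Real.exp (-(2 * |w|)) * Real.exp (2 * |w|) = 1 := by rw [← Real.exp_add]; simp
  have h4 := Real.exp_pos (2 * |w|)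
  nlinarith

/-- The sign of `w`, as a real number in `{1, -1}`; it is `1` at `w = 0`. -/
noncomputable def couplingSign (w : ℝ) : ℝ := if 0 ≤ w then 1 else -1

theorem abs_couplingSign (w : ℝ) : |couplingSign w| = 1 := by
  unfold couplingSign; split_ifs <;> simp

theorem exp_coupling_eq (w : ℝ) (s t : ℤˣ) :
    Real.exp (w * (((s : ℤ) : ℝ) * ((t : ℤ) : ℝ))) = Real.exp (-|w|) *
      Real.cosh (hiddenCoupling w * (((s : ℤ) : ℝ) + couplingSign w * ((t : ℤ) : ℝ))) := by
  have h2 := cosh_two_mul_hiddenCoupling w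
  have h2' : Real.cosh (hiddenCoupling w * (1 + 1)) = Real.exp (2 * |w|) := by
    rw [← h2]; ring_nf
  have h2'' : Real.cosh (hiddenCoupling w * (-1 + -1)) = Real.exp (2 * |w|) := by
    rw [← h2, ← Real.cosh_neg]; ring_nf
  unfold couplingSign
  rcases Int.units_eq_one_or s with rfl | rfl <;> rcases Int.units_eq_one_or t with rfl | rfl <;>
    by_cases hw : 0 ≤ w <;>
    simp [hw, h2', h2'', abs_of_nonneg, abs_of_nonpos, le_of_not_ge] <;>
    (rw [← Real.exp_add]; ring_nf)

/-- The coupling of the spin at `i` with the hidden spin attached to the ordered pair `e`. It vanishes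
unless `i` is in the pair; only the second member of the pair sees the sign of `w`. -/
noncomputable def decoration (w : ι → ι → ℝ) (i : ι) (e : ι × ι) : ℝ :=
  hiddenCoupling (w e.1 e.2) *
    ((if e.1 = i then 1 else 0) + couplingSign (w e.1 e.2) * if e.2 = i then 1 else 0)

theorem sum_decoration_mul (w : ι → ι → ℝ) (ε : ι → ℤˣ) (e : ι × ι) :
    ∑ i, decoration w i e * ((ε i : ℤ) : ℝ) = hiddenCoupling (w e.1 e.2) *
      (((ε e.1 : ℤ) : ℝ) + couplingSign (w e.1 e.2) * ((ε e.2 : ℤ) : ℝ)) := by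
  simp only [decoration, mul_assoc, add_mul, ← Finset.mul_sum, Finset.sum_add_distrib]
  simp

/-- The Gibbs weight of a pair interaction is a mixture of weights of independent spins. -/
theorem exp_pair_interaction_eq (w : ι → ι → ℝ) (b : ι → ℝ) (ε : ι → ℤˣ) :
    Real.exp (∑ i, ∑ j, w i j * (((ε i : ℤ) : ℝ) * ((ε j : ℤ) : ℝ))
        + ∑ i, b i * ((ε i : ℤ) : ℝ))
      = (∏ e : ι × ι, Real.exp (-|w e.1 e.2|) / 2) * ∑ ξ : ι × ι → ℤˣ,
        Real.exp (∑ i, hiddenField (decoration w) b ξ i * ((ε i : ℤ) : ℝ)) := by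
  simp_rw [sum_hiddenField_mul, Real.exp_add]
  rw [← Finset.mul_sum, sum_exp_linear, mul_left_comm, ← Finset.prod_mul_distrib,
    ← Fintype.sum_prod_type', Real.exp_sum, mul_comm]
  congr 1
  refine Finset.prod_congr rfl fun e _ => ?_
  rw [exp_coupling_eq, sum_decoration_mul]
  ring

theorem sum_decoration_bound (w : ι → ι → ℝ) (L : ℝ) (h1 : ∀ i, ∑ j, |w i j| ≤ L)
    (h2 : ∀ j, ∑ i, |w i j| ≤ L) (ε : ι → ℤˣ) (i : ι) :
    ∑ e, (4 * |∑ k, decoration w k e * ((ε k : ℤ) : ℝ)| * |decoration w i e|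
      + decoration w i e ^ 2 / 2) ≤ 18 * L * Real.exp (2 * L) := by
  have hterm : ∀ e : ι × ι, 4 * |∑ k, decoration w k e * ((ε k : ℤ) : ℝ)| * |decoration w i e|
      + decoration w i e ^ 2 / 2 ≤ 9 * Real.exp (2 * L) * (|w e.1 e.2| *
        ((if e.1 = i then 1 else 0) + if e.2 = i then 1 else 0)) := by
    intro e
    set a := hiddenCoupling (w e.1 e.2) with ha
    set s := couplingSign (w e.1 e.2) with hs
    set t : ℝ := (if e.1 = i then 1 else 0) + if e.2 = i then 1 else 0 with ht
    have hs1 : |s| = 1 := abs_couplingSign _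
    have habs : ∀ u : ℤˣ, |((u : ℤ) : ℝ)| = 1 := fun u => by
      rcases spin_cast_eq u with h | h <;> simp [h]
    have hth : |∑ k, decoration w k e * ((ε k : ℤ) : ℝ)| ≤ |a| * 2 := by
      rw [sum_decoration_mul, abs_mul]
      refine mul_le_mul_of_nonneg_left ((abs_add_le _ _).trans ?_) (abs_nonneg _)
      rw [abs_mul, habs, habs, hs1]; norm_num
    have hM : |decoration w i e| ≤ |a| * t := by
      rw [decoration, abs_mul]
      refine mul_le_mul_of_nonneg_left ((abs_add_le _ _).trans ?_) (abs_nonneg _)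
      rw [abs_mul, hs1, ht]
      split_ifs <;> simp
    have ht0 : 0 ≤ t := by rw [ht]; split_ifs <;> norm_num
    have ht2 : t ^ 2 ≤ 2 * t := by rw [ht]; split_ifs <;> norm_num
    have hL : |w e.1 e.2| ≤ L :=
      (Finset.single_le_sum (f := fun j => |w e.1 j|) (fun j _ => abs_nonneg _)
        (Finset.mem_univ e.2)).trans (h1 e.1)
    have ha2 : a ^ 2 ≤ |w e.1 e.2| * Real.exp (2 * L) := by
      refine (sq_hiddenCoupling_le _).trans ?_
      gcongr
    calc 4 * |∑ k, decoration w k e * ((ε k : ℤ) : ℝ)| * |decoration w i e|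
        + decoration w i e ^ 2 / 2
        ≤ 4 * (|a| * 2) * (|a| * t) + (|a| * t) ^ 2 / 2 := by
          rw [← sq_abs (decoration w i e)]
          gcongr
      _ = a ^ 2 * (8 * t + t ^ 2 / 2) := by rw [← sq_abs a]; ring
      _ ≤ a ^ 2 * (9 * t) := by gcongr; linarith
      _ ≤ (|w e.1 e.2| * Real.exp (2 * L)) * (9 * t) := by gcongr
      _ = _ := by ring
  refine (Finset.sum_le_sum fun e _ => hterm e).trans ?_
  rw [← Finset.mul_sum, Fintype.sum_prod_type]
  simp only [mul_add, Finset.sum_add_distrib, mul_ite, mul_one, mul_zero]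
  have e1 : ∑ k, ∑ l, (if k = i then |w k l| else 0) = ∑ l, |w i l| := by
    rw [Finset.sum_comm]; simp
  have e2 : ∑ k, ∑ l, (if l = i then |w k l| else 0) = ∑ k, |w k i| := by simp
  rw [e1, e2]
  have := Real.exp_pos (2 * L)
  nlinarith [h1 i, h2 i]

/-- Concentration of the Ising model with pair interaction `w` and field `b` on a finite set. -/
theorem sum_window_pair_interaction_le [Nonempty ι] (v : ι → ℝ) (hv : ∀ i, 1 ≤ |v i|) (x : ℝ)
    (w : ι → ι → ℝ) (b : ι → ℝ) (L : ℝ) (h1 : ∀ i, ∑ j, |w i j| ≤ L)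
    (h2 : ∀ j, ∑ i, |w i j| ≤ L) (hb : ∀ i, |b i| ≤ L) :
    ∑ ε : ι → ℤˣ with ∑ i, ((ε i : ℤ) : ℝ) * v i ∈ Set.Ioo (x - 1) (x + 1),
      Real.exp (∑ i, ∑ j, w i j * (((ε i : ℤ) : ℝ) * ((ε j : ℤ) : ℝ))
        + ∑ i, b i * ((ε i : ℤ) : ℝ))
      ≤ 2 * Real.exp (L + 18 * L * Real.exp (2 * L)) / Real.sqrt (Fintype.card ι) *
        ∑ ε : ι → ℤˣ, Real.exp (∑ i, ∑ j, w i j * (((ε i : ℤ) : ℝ) * ((ε j : ℤ) : ℝ))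
          + ∑ i, b i * ((ε i : ℤ) : ℝ)) := by
  simp_rw [exp_pair_interaction_eq]
  rw [← Finset.mul_sum, ← Finset.mul_sum, mul_left_comm]
  refine mul_le_mul_of_nonneg_left ?_ (Finset.prod_nonneg fun e _ => by positivity)
  exact sum_window_mixture_le v hv x (decoration w) b L _ hb (sum_decoration_bound w L h1 h2)

end Mixture

/-! ### The lower bound -/

section LowerBound

theorem sum_spin_mul_spin {ι : Type*} [Fintype ι] (ε v : ι → ℤˣ) :
    ∑ i, ((ε i : ℤ) : ℝ) * ((v i : ℤ) : ℝ)
      = 2 * ((Finset.univ.filter fun i => v i = ε i).card : ℝ) - Fintype.card ι := by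
  have h : ∀ i, ((ε i : ℤ) : ℝ) * ((v i : ℤ) : ℝ) = 2 * (if v i = ε i then 1 else 0) - 1 := by
    intro i
    rcases Int.units_eq_one_or (ε i) with h | h <;>
      rcases Int.units_eq_one_or (v i) with h' | h' <;> rw [h, h']
    · norm_num
    · rw [if_neg (by decide)]; norm_num
    · rw [if_neg (by decide)]; norm_num
    · norm_num
  simp_rw [h]
  rw [Finset.sum_sub_distrib, ← Finset.mul_sum, Finset.sum_boole]
  simp

/-- For fixed `ε` the sum `∑ ε_i v_i` equals `2 * k - n`, where `k` counts the sites with `v_i = ε_i`.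
The window around `x` contains exactly the value with `k = n / 2`, rounded down. -/
theorem card_signs_window {ι : Type*} [Fintype ι] [DecidableEq ι] (ε : ι → ℤˣ) (x : ℝ)
    (hx : x = 2 * ((Fintype.card ι / 2 : ℕ) : ℝ) - Fintype.card ι) :
    (Finset.univ.filter fun v : ι → ℤˣ =>
      ∑ i, ((ε i : ℤ) : ℝ) * ((v i : ℤ) : ℝ) ∈ Set.Ioo (x - 1) (x + 1)).card
      = (Fintype.card ι).choose (Fintype.card ι / 2) := by
  have hiff : ∀ v : ι → ℤˣ,
      ∑ i, ((ε i : ℤ) : ℝ) * ((v i : ℤ) : ℝ) ∈ Set.Ioo (x - 1) (x + 1)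
        ↔ (Finset.univ.filter fun i => v i = ε i).card = Fintype.card ι / 2 := by
    intro v
    rw [sum_spin_mul_spin, hx, Set.mem_Ioo]
    set k := (Finset.univ.filter fun i => v i = ε i).card
    set m := Fintype.card ι / 2
    constructor
    · rintro ⟨h1, h2⟩
      have h3 : (m : ℝ) < k + 1 := by linarith
      have h4 : (k : ℝ) < m + 1 := by linarith
      norm_cast at h3 h4
      omega
    · intro h
      rw [h]
      constructor <;> linarith
  simp_rw [hiff]
  rw [← Finset.card_univ, ← Finset.card_powersetCard]
  refine Finset.card_nbij' (fun v => Finset.univ.filter fun i => v i = ε i)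
    (fun s i => if i ∈ s then ε i else -ε i) ?_ ?_ ?_ ?_
  · intro v hv
    exact Finset.mem_powersetCard.2 ⟨Finset.subset_univ _, (Finset.mem_filter.1 hv).2⟩
  · intro s hs
    have hs' := (Finset.mem_powersetCard.1 hs).2
    have : (Finset.univ.filter fun i => (if i ∈ s then ε i else -ε i) = ε i) = s := by
      ext i
      by_cases hi : i ∈ s <;> simp [hi, units_ne_neg_self, eq_comm]
    exact Finset.mem_filter.2 ⟨Finset.mem_univ _, by rw [this]; exact hs'⟩
  · intro v _
    funext i
    by_cases h : v i = ε i
    · simp [h]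
    · simp only [Finset.mem_filter, Finset.mem_univ, true_and, h, if_false]
      rcases Int.units_eq_one_or (ε i) with h1 | h1 <;>
        rcases Int.units_eq_one_or (v i) with h2 | h2 <;> simp_all
  · intro s _
    ext i
    by_cases hi : i ∈ s <;> simp [hi, units_ne_neg_self, eq_comm]

end LowerBound

/-- This holds for every law `μ`: average over coefficients `v` that are independent fair signs. -/
theorem choose_half_div_le_concentration {V : Type*} {Λ : Finset V} (μ : PMF (Λ → ℤˣ)) :
    (Λ.card.choose (Λ.card / 2) : ℝ≥0∞) / 2 ^ Λ.card ≤ concentration μ := by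
  classical
  set x : ℝ := 2 * ((Fintype.card Λ / 2 : ℕ) : ℝ) - Fintype.card Λ with hx
  have hcard : Fintype.card Λ = Λ.card := Fintype.card_coe Λ
  have hsum : ∑ v : Λ → ℤˣ, μ.toOuterMeasure
      {ε | ∑ i : Λ, ((ε i : ℤ) : ℝ) * ((v i : ℤ) : ℝ) ∈ Set.Ioo (x - 1) (x + 1)}
      = (Λ.card.choose (Λ.card / 2) : ℝ≥0∞) := by
    simp_rw [PMF.toOuterMeasure_apply_fintype, Set.indicator_apply, Set.mem_ofPred_eq]
    rw [Finset.sum_comm]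
    have h : ∀ ε : Λ → ℤˣ, (∑ v : Λ → ℤˣ,
        if ∑ i : Λ, ((ε i : ℤ) : ℝ) * ((v i : ℤ) : ℝ) ∈ Set.Ioo (x - 1) (x + 1) then μ ε else 0)
        = (Λ.card.choose (Λ.card / 2) : ℝ≥0∞) * μ ε := by
      intro ε
      rw [← Finset.sum_filter, Finset.sum_const, card_signs_window ε x hx, hcard, nsmul_eq_mul]
    simp_rw [h]
    rw [← Finset.mul_sum, ← tsum_fintype (L := .unconditional _), μ.tsum_coe, mul_one]
  refine ENNReal.div_le_of_le_mul ?_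
  rw [← hsum]
  refine (Finset.sum_le_card_nsmul _ _ (concentration μ) fun v _ => ?_).trans_eq ?_
  · refine le_iSup_of_le x (le_iSup_of_le (fun i => ((v i : ℤ) : ℝ)) (le_iSup_of_le ?_ le_rfl))
    intro i
    rcases spin_cast_eq (v i) with h | h <;> simp [h]
  · rw [nsmul_eq_mul, mul_comm]
    simp

/-! ### The Hamiltonian as a pair interaction in a field -/

section Hamiltonian

variable {V : Type*}

open Classical in
/-- Inclusion-exclusion: an edge with both endpoints in `Λ` is counted twice in the sum over `i ∈ Λ`
and `j`, and twice in the sum over ordered pairs in `Λ`. -/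
theorem hasSum_edges_touching (Λ : Finset V) (f : Sym2 V → ℝ) (hdiag : ∀ i, f s(i, i) = 0)
    (hs : ∀ i ∈ Λ, Summable fun j => f s(i, j)) :
    HasSum (fun e => if ∃ i ∈ Λ, i ∈ e then f e else 0)
      (∑ i ∈ Λ, ∑' j, f s(i, j) - 1 / 2 * ∑ i ∈ Λ, ∑ j ∈ Λ, f s(i, j)) := by
  have h1 : ∀ i ∈ Λ, HasSum (fun e => if i ∈ e then f e else 0) (∑' j, f s(i, j)) := by
    intro i hi
    have hinj : Function.Injective fun j : V => s(i, j) := fun j k h => Sym2.congr_right.1 h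
    refine (hinj.hasSum_iff ?_).1 ?_
    · intro e he
      refine if_neg fun hie => he ?_
      obtain ⟨j, rfl⟩ := Sym2.mem_iff_exists.1 hie
      exact ⟨j, rfl⟩
    · simpa [Function.comp_def] using (hs i hi).hasSum
  have h2 : ∀ i ∈ Λ, ∀ j ∈ Λ, HasSum (fun e => if e = s(i, j) then f s(i, j) else 0)
      (f s(i, j)) := fun i _ j _ => hasSum_ite_eq _ _
  have h3 := (hasSum_sum h1).sub
    ((hasSum_sum fun i hi => hasSum_sum (h2 i hi)).mul_left (1 / 2 : ℝ))
  refine Eq.mpr (congrArg (HasSum · _) (funext fun e => ?_)) h3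
  induction e with | _ a b
  by_cases hab : a = b
  · subst hab
    have h0 := hdiag a
    have hF : ∀ i j, (if s(a, a) = s(i, j) then f s(i, j) else 0) = 0 := by
      intro i j
      split_ifs with h
      · rw [← h, h0]
      · rfl
    simp_rw [hF]
    simp [h0]
  · have hA : ∀ i, (if i ∈ s(a, b) then f s(a, b) else 0)
        = (if i = a then f s(a, b) else 0) + if i = b then f s(a, b) else 0 := by
      intro i
      by_cases ha : i = a
      · subst ha; simp [hab]
      · by_cases hb : i = b <;> simp [ha, hb, Ne.symm hab]
    have hB : ∀ i j, (if s(a, b) = s(i, j) then f s(i, j) else 0)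
        = (if i = a then if j = b then f s(a, b) else 0 else 0)
          + if i = b then if j = a then f s(a, b) else 0 else 0 := by
      intro i j
      by_cases hij : s(a, b) = s(i, j)
      · rw [if_pos hij, ← hij]
        rcases Sym2.eq_iff.1 hij with ⟨rfl, rfl⟩ | ⟨rfl, rfl⟩
        · simp [hab]
        · simp [Ne.symm hab]
      · rw [if_neg hij]
        rw [Sym2.eq_iff] at hij
        push Not at hij
        split_ifs with h1 h2 h3 h4 <;> simp_all
    have hT : (∃ i ∈ Λ, i ∈ s(a, b)) ↔ a ∈ Λ ∨ b ∈ Λ := by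
      simp [and_or_left, exists_or]
    simp_rw [hT, hA, hB, Finset.sum_add_distrib, Finset.sum_ite_irrel, Finset.sum_ite_eq',
      Finset.sum_const_zero, Finset.sum_ite_eq']
    by_cases ha : a ∈ Λ <;> by_cases hb : b ∈ Λ <;> simp [ha, hb]
    ring

/-- The field that the boundary condition `κ` exerts on `i`, up to a factor `1 / 2`. -/
noncomputable def boundaryField (J : Sym2 V → ℝ) (Λ : Finset V) (κ : {j : V // j ∉ Λ} → ℤˣ)
    (i : V) : ℝ :=
  ∑' j : {j : V // j ∉ Λ}, J s(i, (j : V)) * ((κ j : ℤ) : ℝ)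

theorem abs_mul_spin (a : ℝ) (s : ℤˣ) : |a * ((s : ℤ) : ℝ)| = |a| := by
  rcases spin_cast_eq s with h | h <;> simp [h]

theorem hasSum_mul_extend (J : Sym2 V → ℝ) (Λ : Finset V) (κ : {j : V // j ∉ Λ} → ℤˣ)
    (σ : Λ → ℤˣ) (i : V) (hs : Summable fun j => |J s(i, j)|) :
    HasSum (fun j => J s(i, j) * ((extend Λ κ σ j : ℤ) : ℝ))
      (∑ j : Λ, J s(i, (j : V)) * ((σ j : ℤ) : ℝ) + boundaryField J Λ κ i) := by
  have hsum : Summable fun j => J s(i, j) * ((extend Λ κ σ j : ℤ) : ℝ) := by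
    refine Summable.of_abs ?_
    simpa only [abs_mul_spin] using hs
  have h := hsum.sum_add_tsum_subtype_compl Λ
  have h1 : ∑ j ∈ Λ, J s(i, j) * ((extend Λ κ σ j : ℤ) : ℝ)
      = ∑ j : Λ, J s(i, (j : V)) * ((σ j : ℤ) : ℝ) := by
    rw [← Finset.sum_coe_sort]
    exact Finset.sum_congr rfl fun j _ => by simp [extend]
  have h2 : ∑' j : {j : V // j ∉ Λ}, J s(i, (j : V)) * ((extend Λ κ σ j : ℤ) : ℝ)
      = boundaryField J Λ κ i := tsum_congr fun j => by simp [extend, j.2]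
  rw [h1, h2] at h
  rw [h]
  exact hsum.hasSum

/-- Substitute `1_{τ_i = τ_j} = (1 + τ_i τ_j) / 2`. Each edge inside `Λ` appears as two ordered pairs,
hence the factor `1 / 4`. -/
theorem exists_neg_hamiltonian_eq (G : SimpleGraph V) (J : Sym2 V → ℝ)
    (hJ : ∀ e ∉ G.edgeSet, J e = 0) (Λ : Finset V) (h : Λ → ℝ) (κ : {j : V // j ∉ Λ} → ℤˣ)
    (hs : ∀ i ∈ Λ, Summable fun j => |J s(i, j)|) :
    ∃ c : ℝ, ∀ σ : Λ → ℤˣ, -hamiltonian G J Λ h κ σ = c +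
      (∑ i : Λ, ∑ j : Λ, J s((i : V), (j : V)) / 4 * (((σ i : ℤ) : ℝ) * ((σ j : ℤ) : ℝ))
        + ∑ i : Λ, (h i + boundaryField J Λ κ i / 2) * ((σ i : ℤ) : ℝ)) := by
  classical
  refine ⟨∑ i : Λ, ((∑' j, J s((i : V), j)) / 2
    - ∑ j : Λ, J s((i : V), (j : V)) / 4), fun σ => ?_⟩
  set τ := extend Λ κ σ with hτ
  have hτi : ∀ i : Λ, τ i = σ i := fun i => by simp [hτ, extend]
  set f : Sym2 V → ℝ := (agreeing τ).indicator J with hf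
  have hfe : ∀ i j, f s(i, j)
      = 1 / 2 * (J s(i, j) + ((τ i : ℤ) : ℝ) * (J s(i, j) * ((τ j : ℤ) : ℝ))) := by
    intro i j
    rw [hf, Set.indicator_apply, mem_agreeing]
    rcases Int.units_eq_one_or (τ i) with h1 | h1 <;>
      rcases Int.units_eq_one_or (τ j) with h2 | h2 <;> rw [h1, h2]
    · rw [if_pos rfl]; norm_num; ring
    · rw [if_neg (by decide)]; norm_num
    · rw [if_neg (by decide)]; norm_num
    · rw [if_pos rfl]; norm_num; ring
  have hrow : ∀ i ∈ Λ, HasSum (fun j => f s(i, j)) (1 / 2 * (∑' j, J s(i, j) +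
      ((τ i : ℤ) : ℝ) * (∑ j : Λ, J s(i, (j : V)) * ((σ j : ℤ) : ℝ) + boundaryField J Λ κ i))) := by
    intro i hi
    simp_rw [hfe]
    exact ((hs i hi).of_abs.hasSum.add
      ((hasSum_mul_extend J Λ κ σ i (hs i hi)).mul_left _)).mul_left _
  have hdiag : ∀ i, f s(i, i) = 0 := by
    intro i
    rw [hfe, hJ _ (by simp)]
    ring
  have htsum := (hasSum_edges_touching Λ f hdiag fun i hi => (hrow i hi).summable).tsum_eq
  have hedges : ∑' e : edgesTouching G Λ, f e = ∑' e, if ∃ i ∈ Λ, i ∈ e then f e else 0 := by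
    rw [tsum_subtype]
    refine tsum_congr fun e => ?_
    rw [Set.indicator_apply]
    by_cases he : e ∈ G.edgeSet
    · simp [edgesTouching, he]
    · have : f e = 0 := by
        rw [hf, Set.indicator_apply, hJ e he, ite_self]
      simp [this]
  unfold hamiltonian
  rw [← hτ, ← hf, hedges, htsum, Finset.sum_congr rfl fun i hi => (hrow i hi).tsum_eq]
  simp_rw [← Finset.sum_coe_sort Λ, hfe, hτi]
  simp only [Finset.mul_sum, ← Finset.sum_sub_distrib, ← Finset.sum_add_distrib, neg_sub,
    sub_neg_eq_add]
  refine Finset.sum_congr rfl fun i _ => ?_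
  have e1 : ∑ j : Λ, 1 / 2 * (1 / 2 * (J s((i : V), (j : V))
        + ((σ i : ℤ) : ℝ) * (J s((i : V), (j : V)) * ((σ j : ℤ) : ℝ))))
      = (∑ j : Λ, J s((i : V), (j : V))) / 4
        + ((σ i : ℤ) : ℝ) * (∑ j : Λ, J s((i : V), (j : V)) * ((σ j : ℤ) : ℝ)) / 4 := by
    rw [Finset.mul_sum, Finset.sum_div, Finset.sum_div, ← Finset.sum_add_distrib]
    exact Finset.sum_congr rfl fun j _ => by ring
  have e2 : ∑ j : Λ, J s((i : V), (j : V)) / 4 * (((σ i : ℤ) : ℝ) * ((σ j : ℤ) : ℝ))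
      = ((σ i : ℤ) : ℝ) * (∑ j : Λ, J s((i : V), (j : V)) * ((σ j : ℤ) : ℝ)) / 4 := by
    rw [Finset.mul_sum, Finset.sum_div]
    exact Finset.sum_congr rfl fun j _ => by ring
  rw [e1, e2, ← Finset.sum_div]
  ring

theorem summable_and_tsum_add_abs_le_of_strength_le (J : Sym2 V → ℝ) (Λ : Finset V) (h : Λ → ℝ)
    (K : ℝ≥0) (hK : strength J Λ h ≤ K) (i : Λ) :
    (Summable fun j => |J s((i : V), j)|) ∧ ∑' j, |J s((i : V), j)| + |h i| ≤ K := by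
  have h1 : ∑' j : V, ‖J s((i : V), j)‖ₑ + ‖h i‖ₑ ≤ K :=
    (add_le_add (le_iSup (fun i : Λ => ∑' j : V, ‖J s((i : V), j)‖ₑ) i)
      (le_iSup (fun i : Λ => ‖h i‖ₑ) i)).trans hK
  have hsn : Summable fun j => ‖J s((i : V), j)‖₊ := by
    rw [← ENNReal.tsum_coe_ne_top_iff_summable]
    exact ne_top_of_le_ne_top ENNReal.coe_ne_top (le_self_add.trans h1)
  have h2 : ∑' j : V, ‖J s((i : V), j)‖₊ + ‖h i‖₊ ≤ K := by
    rw [← ENNReal.coe_le_coe, ENNReal.coe_add, ENNReal.coe_tsum hsn]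
    exact h1
  refine ⟨by simpa using NNReal.summable_coe.2 hsn, ?_⟩
  have h3 := NNReal.coe_le_coe.2 h2
  rw [NNReal.coe_add, NNReal.coe_tsum] at h3
  simpa using h3

theorem abs_boundaryField_le (J : Sym2 V → ℝ) (Λ : Finset V) (κ : {j : V // j ∉ Λ} → ℤˣ) (i : V)
    (hs : Summable fun j => |J s(i, j)|) :
    |boundaryField J Λ κ i| ≤ ∑' j, |J s(i, j)| := by
  have hsub : Summable fun j : {j : V // j ∉ Λ} => |J s(i, (j : V))| := hs.subtype _
  have h1 : |boundaryField J Λ κ i| ≤ ∑' j : {j : V // j ∉ Λ}, |J s(i, (j : V))| := by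
    have hn : Summable fun j : {j : V // j ∉ Λ} => ‖J s(i, (j : V)) * ((κ j : ℤ) : ℝ)‖ := by
      simpa only [Real.norm_eq_abs, abs_mul_spin] using hsub
    have := norm_tsum_le_tsum_norm hn
    rw [boundaryField]
    simpa only [Real.norm_eq_abs, abs_mul_spin] using this
  exact h1.trans (hs.tsum_subtype_le _ {j | j ∉ Λ} fun j => abs_nonneg _)

/-! ### The upper bound -/

open Classical in
theorem gibbs_toOuterMeasure_apply (G : SimpleGraph V) (J : Sym2 V → ℝ) (Λ : Finset V)
    (h : Λ → ℝ) (κ : {j : V // j ∉ Λ} → ℤˣ) (S : Set (Λ → ℤˣ)) :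
    (gibbs G J Λ h κ).toOuterMeasure S = ENNReal.ofReal
      ((∑ σ : Λ → ℤˣ with σ ∈ S, Real.exp (-hamiltonian G J Λ h κ σ))
        / ∑ σ : Λ → ℤˣ, Real.exp (-hamiltonian G J Λ h κ σ)) := by
  have hZ := partitionFunction_pos G J Λ h κ
  change _ = ENNReal.ofReal (_ / partitionFunction G J Λ h κ)
  rw [PMF.toOuterMeasure_apply_fintype, Finset.sum_div,
    ENNReal.ofReal_sum_of_nonneg (fun σ _ => div_nonneg (Real.exp_pos _).le hZ.le),
    Finset.sum_filter]
  simp only [Set.indicator_apply, gibbs, PMF.ofFintype_apply]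

theorem concentration_gibbs_le (G : SimpleGraph V) (J : Sym2 V → ℝ)
    (hJ : ∀ e ∉ G.edgeSet, J e = 0) (Λ : Finset V) (hΛ : Λ.Nonempty) (h : Λ → ℝ)
    (κ : {j : V // j ∉ Λ} → ℤˣ) (K : ℝ≥0) (hK : strength J Λ h ≤ K) :
    concentration (gibbs G J Λ h κ) ≤ ENNReal.ofReal
      (2 * Real.exp (K + 18 * K * Real.exp (2 * K)) / Real.sqrt Λ.card) := by
  classical
  have hbound := summable_and_tsum_add_abs_le_of_strength_le J Λ h K hK
  obtain ⟨c, hc⟩ := exists_neg_hamiltonian_eq G J hJ Λ h κ fun i hi => (hbound ⟨i, hi⟩).1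
  have : Nonempty Λ := hΛ.to_subtype
  have hrow : ∀ i : Λ, ∑ j : Λ, |J s((i : V), (j : V)) / 4| ≤ K := by
    intro i
    have h1 : ∑ j : Λ, |J s((i : V), (j : V))| ≤ ∑' j, |J s((i : V), j)| := by
      rw [Finset.sum_coe_sort Λ fun j => |J s((i : V), j)|]
      exact (hbound i).1.sum_le_tsum _ fun j _ => abs_nonneg _
    have h2 : ∑ j : Λ, |J s((i : V), (j : V)) / 4| ≤ ∑ j : Λ, |J s((i : V), (j : V))| :=
      Finset.sum_le_sum fun j _ => by
        rw [abs_div, abs_of_pos (by norm_num : (0 : ℝ) < 4)]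
        linarith [abs_nonneg (J s((i : V), (j : V)))]
    linarith [(hbound i).2, abs_nonneg (h i)]
  have hcol : ∀ j : Λ, ∑ i : Λ, |J s((i : V), (j : V)) / 4| ≤ K := by
    intro j
    simpa only [Sym2.eq_swap] using hrow j
  have hfield : ∀ i : Λ, |h i + boundaryField J Λ κ i / 2| ≤ K := by
    intro i
    have h1 := abs_boundaryField_le J Λ κ i (hbound i).1
    have h2 := abs_add_le (h i) (boundaryField J Λ κ i / 2)
    rw [abs_div, abs_of_pos (two_pos : (0 : ℝ) < 2)] at h2
    linarith [(hbound i).2, abs_nonneg (boundaryField J Λ κ i)]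
  refine iSup_le fun x => iSup_le fun v => iSup_le fun hv => ?_
  rw [gibbs_toOuterMeasure_apply]
  refine ENNReal.ofReal_le_ofReal ?_
  rw [div_le_iff₀ (Finset.sum_pos (fun _ _ => Real.exp_pos _) Finset.univ_nonempty)]
  have hmain := sum_window_pair_interaction_le v hv x
    (fun i j : Λ => J s((i : V), (j : V)) / 4) (fun i => h i + boundaryField J Λ κ i / 2)
    K hrow hcol hfield
  simp_rw [hc, Real.exp_add c, ← Finset.mul_sum]
  rw [mul_left_comm]
  refine mul_le_mul_of_nonneg_left ?_ (Real.exp_pos c).le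
  rw [Fintype.card_coe] at hmain
  exact (Finset.sum_congr (by ext; simp) fun _ _ => rfl).trans_le hmain

end Hamiltonian

end Ising

theorem theorem1 :
    ∃ C : ℝ≥0 → ℝ, ∀ (V : Type*) (G : SimpleGraph V) (J : Sym2 V → ℝ),
      (∀ e ∉ G.edgeSet, J e = 0) →
      ∀ (I : Set ℕ) (Λ : ℕ → Finset V),
      (∀ n ∈ I, 1 ≤ n ∧ (Λ n).card = n) →
      ∀ (h : (n : ℕ) → Λ n → ℝ) (κ : (n : ℕ) → {j : V // j ∉ Λ n} → ℤˣ) (K : ℝ≥0),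
      (K : ℝ≥0∞) ≥ (⨆ n ∈ I, Ising.strength J (Λ n) (h n)) →
      ∀ n ∈ I,
        (n.choose (n / 2) : ℝ≥0∞) / 2 ^ n
            ≤ Ising.concentration (Ising.gibbs G J (Λ n) (h n) (κ n)) ∧
        Ising.concentration (Ising.gibbs G J (Λ n) (h n) (κ n))
            ≤ ENNReal.ofReal (C K * (n : ℝ) ^ (-(1 / 2) : ℝ)) := by
  refine ⟨fun K => 2 * Real.exp (K + 18 * K * Real.exp (2 * K)), ?_⟩
  intro V G J hJ I Λ hΛ h κ K hK n hn
  obtain ⟨hn1, hcard⟩ := hΛ n hn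
  have hKn : Ising.strength J (Λ n) (h n) ≤ K :=
    (le_iSup₂ (f := fun n (_ : n ∈ I) => Ising.strength J (Λ n) (h n)) n hn).trans hK
  constructor
  · have := Ising.choose_half_div_le_concentration (Ising.gibbs G J (Λ n) (h n) (κ n))
    rwa [hcard] at this
  · have hne : (Λ n).Nonempty := Finset.card_pos.1 (by omega)
    have := Ising.concentration_gibbs_le G J hJ (Λ n) hne (h n) (κ n) K hKn
    rwa [hcard, div_eq_mul_inv, Real.sqrt_eq_rpow, ← Real.rpow_neg (Nat.cast_nonneg n)] at this
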